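/- Let $K$ be an algebraically closed field of characteristic zero, and let $\mathfrak{sl}_2(K)$ be the Lie algebra of traceless $2\times 2$ matrices over $K$ with bracket $[x,y]=xy-yx$. Let $\mathfrak{s}$ be a finite-dimensional Lie algebra over $K$, and let $\alpha\colon\mathfrak{sl}_2(K)\to\mathfrak{s}$ be a bijection (not assumed to be additive) that preserves commutators, i.e. $\alpha([x,y])=[\alpha(x),\alpha(y)]$ for all $x,y\in\mathfrak{sl}_2(K)$. Then $\alpha$ is semilinear, that is, $\alpha(x+y)=\alpha(x)+\alpha(y)$ for all $x,y\in\mathfrak{sl}_2(K)$, and there is a field automorphism $\theta\in\mathrm{Aut}(K)$ such that $\alpha(\lambda x)=\theta(\lambda)\alpha(x)$ for all $\lambda\in K$ and $x\in\mathfrak{sl}_2(K)$. -/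

import Mathlib

/-- A map between `K`-vector spaces is semilinear if it is additive and there is a field
automorphism `θ` of `K` with `α (c • x) = θ c • α x` for all scalars `c` and vectors `x`. -/
def IsSemilinear (K : Type*) [Field K] {V W : Type*} [AddCommGroup V] [Module K V]
    [AddCommGroup W] [Module K W] (α : V → W) : Prop :=
  (∀ x y : V, α (x + y) = α x + α y) ∧
    ∃ θ : K ≃+* K, ∀ (c : K) (x : V), α (c • x) = θ c • α x

/-! Brackets detect linear structure: a centralizer in the target is a linear subspace, and
bijectivity identifies it with the image of a centralizer in `sl₂`. An eigenvector of `ad (F 0 r 0)`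
on the centralizer of `F 1 0 0` forces `F 0 r 0 = θ r • F 0 1 0` (`exists_smul_h`). Brackets then
make `θ` multiplicative, give linear coordinates on the target, and finally make `θ` additive. -/

open LieAlgebra.SpecialLinear in
/-- The traceless matrix with coordinates `(a, b, c)` in the basis `e, h / 2, f` of `sl₂`. -/
noncomputable def slTwoMk {K : Type*} [Field K] (a b c : K) : sl (Fin 2) K :=
  ⟨!![b / 2, a; c, -(b / 2)], by
    change Matrix.traceLinearMap (Fin 2) K K _ = 0
    simp [Matrix.trace_fin_two]⟩

section Coordinates

variable {K : Type*} [Field K]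

theorem slTwoMk_add (a b c a' b' c' : K) :
    slTwoMk a b c + slTwoMk a' b' c' = slTwoMk (a + a') (b + b') (c + c') := by
  apply Subtype.ext
  ext i j
  fin_cases i <;> fin_cases j <;> simp [slTwoMk] <;> ring

theorem slTwoMk_smul (r a b c : K) :
    r • slTwoMk a b c = slTwoMk (r * a) (r * b) (r * c) := by
  apply Subtype.ext
  ext i j
  fin_cases i <;> fin_cases j <;> simp [slTwoMk] <;> ring

variable [CharZero K]

theorem slTwoMk_lie (a b c a' b' c' : K) :
    ⁅slTwoMk a b c, slTwoMk a' b' c'⁆ =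
      slTwoMk (b * a' - a * b') (2 * (a * c' - c * a')) (c * b' - b * c') := by
  apply Subtype.ext
  ext i j
  fin_cases i <;> fin_cases j <;>
    simp [slTwoMk, Ring.lie_def] <;> field_simp <;> ring

theorem exists_eq_slTwoMk (x : LieAlgebra.SpecialLinear.sl (Fin 2) K) :
    ∃ a b c, x = slTwoMk a b c := by
  have h : x.1.trace = 0 := x.2
  rw [Matrix.trace_fin_two] at h
  refine ⟨x.1 0 1, 2 * x.1 0 0, x.1 1 0, Subtype.ext ?_⟩
  ext i j
  fin_cases i <;> fin_cases j <;> simp [slTwoMk]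
  linear_combination h

theorem slTwoMk_inj {a b c a' b' c' : K} (h : slTwoMk a b c = slTwoMk a' b' c') :
    a = a' ∧ b = b' ∧ c = c' := by
  have h' := congrArg Subtype.val h
  have h1 := congrFun (congrFun h' 0) 0
  have h2 := congrFun (congrFun h' 0) 1
  have h3 := congrFun (congrFun h' 1) 0
  simp [slTwoMk] at h1 h2 h3
  exact ⟨h2, h1, h3⟩

end Coordinates

/-- A bijection `F` from `K³` to a Lie algebra, multiplicative for the bracket of `sl₂` in the
coordinates of `slTwoMk`. -/
structure IsSlTwoParam {K : Type*} [Field K] {L : Type*} [LieRing L]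
    (F : K → K → K → L) : Prop where
  inj : ∀ {a b c a' b' c'}, F a b c = F a' b' c' → a = a' ∧ b = b' ∧ c = c'
  surj : ∀ y, ∃ a b c, F a b c = y
  lie : ∀ a b c a' b' c', ⁅F a b c, F a' b' c'⁆ =
    F (b * a' - a * b') (2 * (a * c' - c * a')) (c * b' - b * c')

namespace IsSlTwoParam

variable {K : Type*} [Field K] {L : Type*} [LieRing L] {F : K → K → K → L}

theorem zero (hF : IsSlTwoParam F) : F 0 0 0 = 0 := by
  have := hF.lie 0 0 0 0 0 0
  simpa using this.symm

theorem eq_zero (hF : IsSlTwoParam F) {a b c : K} (h : F a b c = 0) :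
    a = 0 ∧ b = 0 ∧ c = 0 :=
  hF.inj (h.trans hF.zero.symm)

theorem exists_of_lie_h_eq_zero (hF : IsSlTwoParam F) {y : L} (h : ⁅F 0 1 0, y⁆ = 0) :
    ∃ b, y = F 0 b 0 := by
  obtain ⟨a, b, c, rfl⟩ := hF.surj y
  rw [hF.lie] at h
  obtain ⟨h1, -, h3⟩ := hF.eq_zero h
  exact ⟨b, by simp_all⟩

theorem h_lie_e (hF : IsSlTwoParam F) (r s : K) : ⁅F 0 r 0, F s 0 0⁆ = F (r * s) 0 0 := by
  simp [hF.lie]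

variable [CharZero K]

theorem exists_of_lie_e_eq_zero (hF : IsSlTwoParam F) {y : L} (h : ⁅F 1 0 0, y⁆ = 0) :
    ∃ a, y = F a 0 0 := by
  obtain ⟨a, b, c, rfl⟩ := hF.surj y
  rw [hF.lie] at h
  obtain ⟨h1, h2, -⟩ := hF.eq_zero h
  exact ⟨a, by simp_all⟩

variable [LieAlgebra K L]

/-- The centralizer of the image of `h` is a line. -/
theorem exists_smul_h [IsAlgClosed K] [FiniteDimensional K L] (hF : IsSlTwoParam F) (r : K) :
    ∃ t : K, F 0 r 0 = t • F 0 1 0 := by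
  let U : Submodule K L := LinearMap.ker (LieAlgebra.ad K L (F 1 0 0))
  have memU : ∀ y, y ∈ U ↔ ∃ a, y = F a 0 0 := fun y => by
    simp only [U, LinearMap.mem_ker]
    refine ⟨fun h => hF.exists_of_lie_e_eq_zero h, ?_⟩
    rintro ⟨a, rfl⟩
    change ⁅F 1 0 0, F a 0 0⁆ = 0
    simp [hF.lie, hF.zero]
  have maps : ∀ y ∈ U, LieAlgebra.ad K L (F 0 r 0) y ∈ U := fun y hy => by
    obtain ⟨a, rfl⟩ := (memU y).1 hy
    rw [LieAlgebra.ad_apply, hF.h_lie_e, memU]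
    exact ⟨_, rfl⟩
  have : Nontrivial U := by
    refine ⟨⟨⟨F 1 0 0, (memU _).2 ⟨1, rfl⟩⟩, 0, fun h => ?_⟩⟩
    exact one_ne_zero (hF.eq_zero (congrArg Subtype.val h)).1
  obtain ⟨t, ht⟩ := Module.End.exists_eigenvalue
    (LinearMap.restrict (LieAlgebra.ad K L (F 0 r 0)) maps)
  obtain ⟨⟨y, hyU⟩, hy⟩ := ht.exists_hasEigenvector
  have hy1 : ⁅F 0 r 0, y⁆ = t • y := congrArg Subtype.val hy.apply_eq_smul
  have hy0 : y ≠ 0 := fun h => hy.2 (Subtype.ext h)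
  obtain ⟨m, rfl⟩ := (memU y).1 hyU
  refine ⟨t, ?_⟩
  -- The difference centralizes `F 0 1 0`, so it is some `F 0 n 0`; it also kills the eigenvector `F
  -- m 0 0`, so `n * m = 0` with `m ≠ 0`.
  have hcomm : ⁅F 0 1 0, F 0 r 0 - t • F 0 1 0⁆ = 0 := by
    simp [hF.lie, hF.zero]
  obtain ⟨n, hn⟩ := hF.exists_of_lie_h_eq_zero hcomm
  have hkill : ⁅F 0 n 0, F m 0 0⁆ = 0 := by
    rw [← hn, sub_lie, hy1, smul_lie, hF.h_lie_e, one_mul, sub_self]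
  rw [hF.h_lie_e] at hkill
  rcases mul_eq_zero.1 (hF.eq_zero hkill).1 with h | h
  · rwa [h, hF.zero, sub_eq_zero] at hn
  · exact absurd (h ▸ hF.zero) hy0

/-- The parametrization is the standard one twisted by a field automorphism. -/
theorem exists_ringEquiv [IsAlgClosed K] [FiniteDimensional K L] (hF : IsSlTwoParam F) :
    ∃ θ : K ≃+* K, ∀ a b c,
      F a b c = θ a • F 1 0 0 + θ b • F 0 1 0 + θ c • F 0 0 1 := by
  choose θ hh using hF.exists_smul_h
  have hE : F 1 0 0 ≠ 0 := fun h => one_ne_zero (hF.eq_zero h).1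
  have hH : F 0 1 0 ≠ 0 := fun h => one_ne_zero (hF.eq_zero h).2.1
  have hG : F 0 0 1 ≠ 0 := fun h => one_ne_zero (hF.eq_zero h).2.2
  have he : ∀ r, F r 0 0 = θ r • F 1 0 0 := fun r => by
    have := hF.h_lie_e r 1
    rw [hh, smul_lie, hF.h_lie_e, one_mul, mul_one] at this
    exact this.symm
  have lGH : ⁅F 0 0 1, F 0 1 0⁆ = F 0 0 1 := by simp [hF.lie]
  have lHE : ⁅F 0 1 0, F 1 0 0⁆ = F 1 0 0 := by simp [hF.lie]
  have lEH : ⁅F 1 0 0, F 0 1 0⁆ = -F 1 0 0 := by rw [← lie_skew, lHE]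
  have lHG' : ⁅F 0 1 0, F 0 0 1⁆ = -F 0 0 1 := by rw [← lie_skew, lGH]
  have lEG : ⁅F 1 0 0, F 0 0 1⁆ = θ 2 • F 0 1 0 := by rw [← hh]; simp [hF.lie]
  have lGE : ⁅F 0 0 1, F 1 0 0⁆ = -(θ 2 • F 0 1 0) := by rw [← lie_skew, lEG]
  have hf : ∀ r, F 0 0 r = θ r • F 0 0 1 := fun r => by
    have : ⁅F 0 0 1, F 0 r 0⁆ = F 0 0 r := by simp [hF.lie]
    rw [hh, lie_smul, lGH] at this
    exact this.symm
  have θ0 : θ 0 = 0 := by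
    have := he 0
    rw [hF.zero] at this
    exact (smul_eq_zero.1 this.symm).resolve_right hE
  have θ1 : θ 1 = 1 := by
    have := he 1
    refine smul_left_injective K hE ?_
    simpa using this.symm
  have θmul : ∀ r s, θ (r * s) = θ r * θ s := fun r s => by
    have := hF.h_lie_e r s
    rw [hh, he s, he (r * s), smul_lie, lie_smul, lHE, smul_smul] at this
    exact (smul_left_injective K hE this).symm
  have θneg : ∀ r, θ (-r) = -θ r := fun r => by
    have : ⁅F 1 0 0, F 0 r 0⁆ = F (-r) 0 0 := by simp [hF.lie]
    rw [hh, lie_smul, lEH, he (-r)] at this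
    refine smul_left_injective K hE ?_
    simpa using this.symm
  have θinj : Function.Injective θ := fun r s h => (hF.inj (((hh r).trans (h ▸ rfl)).trans
    (hh s).symm)).2.1
  have θ2 : θ 2 ≠ 0 := fun h => two_ne_zero (θinj (h.trans θ0.symm))
  have θsurj : Function.Surjective θ := fun t => by
    obtain ⟨b, hb⟩ := hF.exists_of_lie_h_eq_zero (y := t • F 0 1 0) (by simp)
    refine ⟨b, smul_left_injective K hH ?_⟩
    exact (hh b).symm.trans hb.symm
  have kerE : ∀ y, ⁅F 1 0 0, y⁆ = 0 → ∃ t : K, y = t • F 1 0 0 := fun y hy => by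
    obtain ⟨a, rfl⟩ := hF.exists_of_lie_e_eq_zero hy
    exact ⟨_, he a⟩
  have coords : ∀ a b c, F a b c = θ a • F 1 0 0 + θ b • F 0 1 0 + θ c • F 0 0 1 := by
    intro a b c
    have eey : ⁅F 1 0 0, ⁅F 1 0 0, F a b c⁆⁆ = -(θ 2 * θ c) • F 1 0 0 := by
      rw [← θmul, ← θneg, ← he]; simp [hF.lie]
    have ggy : ⁅F 0 0 1, ⁅F 0 0 1, F a b c⁆⁆ = -(θ 2 * θ a) • F 0 0 1 := by
      rw [← θmul, ← θneg, ← hf]; simp [hF.lie]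
    have hgy : ⁅F 0 1 0, ⁅F 0 0 1, F a b c⁆⁆ = -(θ b) • F 0 0 1 := by
      rw [← θneg, ← hf]; simp [hF.lie]
    -- Additivity of `F` is not available, so components are peeled off linearly: each correction
    -- lands in the kernel of `ad (F 1 0 0)`, a line.
    obtain ⟨s, hs⟩ := kerE (⁅F 1 0 0, F a b c - θ c • F 0 0 1⁆) (by
      simp only [lie_sub, lie_smul, eey, lEG, lEH]
      module)
    obtain ⟨t, ht⟩ := kerE (F a b c - θ c • F 0 0 1 + s • F 0 1 0) (by
      rw [lie_add, hs, lie_smul, lEH]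
      module)
    have hy : F a b c = t • F 1 0 0 + (-s) • F 0 1 0 + θ c • F 0 0 1 := by
      rw [← ht]; module
    rw [hy] at ggy hgy
    simp only [lie_add, lie_smul, lGE, lGH, lHG', lie_self, lie_neg, lie_zero, smul_zero] at ggy hgy
    have h1 : t = θ a := by
      have : (-(θ 2 * t)) • F 0 0 1 = -(θ 2 * θ a) • F 0 0 1 := by
        rw [← ggy]; module
      have := smul_left_injective K hG this
      exact mul_left_cancel₀ θ2 (neg_injective this)
    have h2 : -s = θ b := by
      have : (-(-s)) • F 0 0 1 = -(θ b) • F 0 0 1 := by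
        rw [← hgy]; module
      exact neg_injective (smul_left_injective K hG this)
    rw [hy, h1, h2]
  have θadd : ∀ r s, θ (r + s) = θ r + θ s := fun r s => by
    -- A single bracket produces the sum `r + s`; expanding it bilinearly through `coords` gives `θ
    -- r + θ s`.
    have h : ⁅F (-s) 1 0, F r 1 0⁆ = F (r + s) 0 0 := by simp [hF.lie]
    rw [coords (-s), coords r, he (r + s)] at h
    simp only [θ0, θ1, θneg, one_smul, zero_smul, add_zero, lie_add, add_lie, lie_smul, smul_lie,
      lie_self, lEH, lHE, smul_zero] at h
    refine smul_left_injective K hE (h.symm.trans ?_)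
    module
  exact ⟨RingEquiv.ofBijective (⟨⟨⟨θ, θ1⟩, θmul⟩, θ0, θadd⟩ : K →+* K) ⟨θinj, θsurj⟩, coords⟩

end IsSlTwoParam

theorem mainTheorem12 {K : Type*} [Field K] [IsAlgClosed K] [CharZero K]
    {𝔰 : Type*} [LieRing 𝔰] [LieAlgebra K 𝔰] [FiniteDimensional K 𝔰]
    (α : LieAlgebra.SpecialLinear.sl (Fin 2) K → 𝔰) (hα : Function.Bijective α)
    (hcomm : ∀ x y : LieAlgebra.SpecialLinear.sl (Fin 2) K, α ⁅x, y⁆ = ⁅α x, α y⁆) :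
    IsSemilinear K α := by
  have hF : IsSlTwoParam (fun a b c : K => α (slTwoMk a b c)) := by
    refine ⟨fun h => slTwoMk_inj (hα.1 h), fun y => ?_, fun a b c a' b' c' => ?_⟩
    · obtain ⟨x, rfl⟩ := hα.2 y
      obtain ⟨a, b, c, rfl⟩ := exists_eq_slTwoMk x
      exact ⟨a, b, c, rfl⟩
    · rw [← slTwoMk_lie, hcomm]
  obtain ⟨θ, hθ⟩ := hF.exists_ringEquiv
  refine ⟨fun x y => ?_, θ, fun r x => ?_⟩
  · obtain ⟨a, b, c, rfl⟩ := exists_eq_slTwoMk x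
    obtain ⟨a', b', c', rfl⟩ := exists_eq_slTwoMk y
    rw [slTwoMk_add, hθ, hθ a, hθ a']
    simp only [map_add]
    module
  · obtain ⟨a, b, c, rfl⟩ := exists_eq_slTwoMk x
    rw [slTwoMk_smul, hθ, hθ a]
    simp only [map_mul]
    module
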